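/- Let $X\neq\emptyset$ be a countable set, let $b:X\times X\to[0,\infty)$ satisfy $b(x,x)=0$, $b(x,y)=b(y,x)$ and $\sum_{z}b(x,z)<\infty$ for all $x,y\in X$, and let $\mu:X\to(0,\infty)$. Let $E=(E_x)_{x\in X}$ be a family of nonzero complex Hilbert spaces with unitary maps $\Phi_{x,y}:E_y\to E_x$ such that $\Phi_{x,y}=\Phi_{y,x}^{-1}$ for all $x,y\in X$, and let $W=(W_x)_{x\in X}$ be a family of bounded self-adjoint operators $W_x:E_x\to E_x$. Let $\ell^2(X,\mu;E)$ be the Hilbert space of sections $f=(f(x))_{x\in X}$, $f(x)\in E_x$, with $\sum_x|f(x)|^2\mu(x)<\infty$, and inner product $\langle f,g\rangle=\sum_x\langle f(x),g(x)\rangle\mu(x)$. Let $\Gamma_c(X;E)$ be the space of finitely supported sections and $\mathcal F_E$ the space of sections $f$ with $\sum_y b(x,y)|f(y)|<\infty$ for all $x\in X$. For $f\in\mathcal F_E$ put $$\mathcal M f(x)=\frac1{\mu(x)}\sum_{y\in X}b(x,y)\bigl(f(x)-\Phi_{x,y}f(y)\bigr)+W_xf(x),\qquad x\in X.$$ A \emph{realization}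 of $\mathcal M$ is a self-adjoint operator $M$ on $\ell^2(X,\mu;E)$ that is semi-bounded from below, whose associated quadratic form has a domain containing $\Gamma_c(X;E)$, and which satisfies $D(M)\subseteq\mathcal F_E$ and $Mf=\mathcal Mf$ for all $f\in D(M)$. The condition (FC) says that for every $x\in X$ the function $y\mapsto b(x,y)/\mu(y)$ belongs to $\ell^2(X,\mu)$; in this case $\mathcal M\Gamma_c(X;E)\subseteq\ell^2(X,\mu;E)$, and $M^{\min}$ denotes the restriction of $\mathcal M$ to $\Gamma_c(X;E)$, as an operator on $\ell^2(X,\mu;E)$. An \emph{infinite path} is a sequence $(x_n)_{n\ge1}$ in $X$, not necessarily injective, with $b(x_n,x_{n+1})>0$ for all $n$. Suppose that $W\ge0$, i.e. $\langle W_x\xi,\xi\rangle\ge0$ for all $x\in X$ and $\xi\in E_x$, and that every infinite path $(x_n)$ satisfies $$\sum_{n=1}^\infty\mu(x_n)=\infty$$ (which is the case, for example, if $\inf_{x\in X}\mu(x)>0$). Then $\mathcal M$ has exactly one realization. If, additionally, (FC) holds, then $M^{\min}$ is essentially self-adjoint. -/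

import Mathlib

open scoped Topology InnerProductSpace

noncomputable section

namespace MagneticSchrodinger

universe u v

/-- A symmetric weighted graph over the vertex set `X`. -/
structure WeightedGraph (X : Type u) where
  /-- the edge weight -/
  b : X → X → ℝ
  nonneg : ∀ x y, 0 ≤ b x y
  loopless : ∀ x, b x x = 0
  symm : ∀ x y, b x y = b y x
  summable : ∀ x, Summable (b x)

/-- Two vertices are connected by an edge. -/
def WeightedGraph.Adj {X : Type u} (G : WeightedGraph X) (x y : X) : Prop := 0 < G.b x y

/-- A weight on `X`, i.e. a strictly positive function. -/
structure Weight (X : Type u) where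
  toFun : X → ℝ
  pos' : ∀ x, 0 < toFun x

instance {X : Type u} : CoeFun (Weight X) (fun _ => X → ℝ) := ⟨Weight.toFun⟩

theorem Weight.pos {X : Type u} (μ : Weight X) (x : X) : 0 < μ x := μ.pos' x

/-- An infinite path: consecutive vertices are joined by an edge (vertices may be revisited). -/
def WeightedGraph.IsInfinitePath {X : Type u} (G : WeightedGraph X) (p : ℕ → X) : Prop :=
  ∀ n, G.Adj (p n) (p (n + 1))

/-- The sum of the weights along any infinite path is infinite. -/
def WeightedGraph.InfinitePathsHaveInfiniteMeasure {X : Type u} (G : WeightedGraph X)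
    (μ : Weight X) : Prop :=
  ∀ p : ℕ → X, G.IsInfinitePath p → ∑' n, ENNReal.ofReal (μ (p n)) = ⊤

/-- The finiteness condition (FC): for all `x` the function `y ↦ b x y / μ y` is in `ℓ²(X, μ)`. -/
def WeightedGraph.FC {X : Type u} (G : WeightedGraph X) (μ : Weight X) : Prop :=
  ∀ x, Summable fun y => (G.b x y / μ y) ^ 2 * μ y

section Bundle

variable {X : Type u} (E : X → Type v) [∀ x, NormedAddCommGroup (E x)]
  [∀ x, InnerProductSpace ℂ (E x)]

/-- A unitary connection on the Hermitian vector bundle `E`. -/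
structure UnitaryConnection where
  map : ∀ x y, E y ≃ₗᵢ[ℂ] E x
  symm : ∀ x y, map x y = (map y x).symm

/-- A self-adjoint bundle endomorphism of `E`: bounded on every fibre, but not necessarily
uniformly in the base point. -/
structure SelfAdjointEndomorphism [∀ x, CompleteSpace (E x)] where
  map : ∀ x, E x →L[ℂ] E x
  selfAdjoint : ∀ x, IsSelfAdjoint (map x)

variable {E} in
/-- `W ≥ 0`. -/
def SelfAdjointEndomorphism.Nonneg [∀ x, CompleteSpace (E x)]
    (W : SelfAdjointEndomorphism E) : Prop :=
  ∀ x (ξ : E x), 0 ≤ (⟪W.map x ξ, ξ⟫_ℂ).re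

/-! ### The Hilbert space of `ℓ²`-sections -/

/-- Rescaling a section by `√μ`. -/
def rescale (μ : Weight X) : (∀ x, E x) →ₗ[ℂ] (∀ x, E x) where
  toFun f x := ((Real.sqrt (μ x) : ℝ) : ℂ) • f x
  map_add' f g := by ext x; simp
  map_smul' c f := by ext x; simp [smul_comm c]

theorem norm_rescale_sq (μ : Weight X) (f : ∀ x, E x) (x : X) :
    ‖rescale E μ f x‖ ^ 2 = ‖f x‖ ^ 2 * μ x := by
  have h := (μ.pos x).le
  simp only [rescale, LinearMap.coe_mk, AddHom.coe_mk, norm_smul, Complex.norm_real, mul_pow]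
  rw [Real.norm_of_nonneg (Real.sqrt_nonneg _), Real.sq_sqrt h, mul_comm]

theorem memLp_rescale_iff (μ : Weight X) (f : ∀ x, E x) :
    Memℓp (rescale E μ f) 2 ↔ Summable fun x => ‖f x‖ ^ 2 * μ x := by
  rw [memℓp_gen_iff (by norm_num)]
  simp [← norm_rescale_sq]

/-- The sections `f` with `∑ |f x|² μ x < ∞`, as a subspace of all sections. -/
def ellTwoSubmodule (μ : Weight X) : Submodule ℂ (∀ x, E x) where
  carrier := {f | Summable fun x => ‖f x‖ ^ 2 * μ x}
  add_mem' {f g} hf hg := by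
    simp only [Set.mem_ofPred_eq, ← memLp_rescale_iff, map_add] at *
    exact hf.add hg
  zero_mem' := by simp
  smul_mem' c f hf := by
    simp only [Set.mem_ofPred_eq, ← memLp_rescale_iff, map_smul] at *
    exact hf.const_smul c

/-- The space `ℓ²(X, μ; E)` of square-summable sections. It is a type of its own so that it
carries the topology of the norm below and not that of pointwise convergence. -/
def EllTwo (μ : Weight X) : Type (max u v) := ellTwoSubmodule E μ

instance (μ : Weight X) : AddCommGroup (EllTwo E μ) :=
  inferInstanceAs (AddCommGroup (ellTwoSubmodule E μ))

instance (μ : Weight X) : Module ℂ (EllTwo E μ) :=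
  inferInstanceAs (Module ℂ (ellTwoSubmodule E μ))

/-- The section underlying an element of `ℓ²(X, μ; E)`. -/
def EllTwo.toSection (μ : Weight X) : EllTwo E μ →ₗ[ℂ] (∀ x, E x) := (ellTwoSubmodule E μ).subtype

instance (μ : Weight X) : CoeFun (EllTwo E μ) (fun _ => ∀ x, E x) := ⟨EllTwo.toSection E μ⟩

/-- A square-summable section as an element of `ℓ²(X, μ; E)`. -/
def EllTwo.mk (μ : Weight X) (f : ∀ x, E x) (hf : Summable fun x => ‖f x‖ ^ 2 * μ x) :
    EllTwo E μ := ⟨f, hf⟩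

theorem EllTwo.toSection_injective (μ : Weight X) : Function.Injective (EllTwo.toSection E μ) :=
  Subtype.coe_injective

variable {E} in
theorem EllTwo.summable {μ : Weight X} (f : EllTwo E μ) : Summable fun x => ‖f x‖ ^ 2 * μ x := f.2

/-- The weighted inner product, linear in the second argument. -/
instance (μ : Weight X) : Inner ℂ (EllTwo E μ) where
  inner f g := ∑' x, ⟪f x, g x⟫_ℂ * (μ x : ℂ)

theorem EllTwo.inner_def (μ : Weight X) (f g : EllTwo E μ) :
    ⟪f, g⟫_ℂ = ∑' x, ⟪f x, g x⟫_ℂ * (μ x : ℂ) := rfl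

theorem sqrt_smul_inv_smul (μ : Weight X) (x : X) (v : E x) :
    ((Real.sqrt (μ x) : ℝ) : ℂ) • ((Real.sqrt (μ x) : ℝ) : ℂ)⁻¹ • v = v :=
  smul_inv_smul₀ (Complex.ofReal_ne_zero.2 (Real.sqrt_pos.2 (μ.pos x)).ne') v

theorem inv_smul_sqrt_smul (μ : Weight X) (x : X) (v : E x) :
    ((Real.sqrt (μ x) : ℝ) : ℂ)⁻¹ • ((Real.sqrt (μ x) : ℝ) : ℂ) • v = v :=
  inv_smul_smul₀ (Complex.ofReal_ne_zero.2 (Real.sqrt_pos.2 (μ.pos x)).ne') v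

theorem rescale_inv (μ : Weight X) (g : ∀ x, E x) :
    rescale E μ (fun x => ((Real.sqrt (μ x) : ℝ) : ℂ)⁻¹ • g x) = g :=
  funext fun x => sqrt_smul_inv_smul E μ x (g x)

/-- The identification of `ℓ²(X, μ; E)` with the unweighted space, given by rescaling. -/
def toLp (μ : Weight X) : EllTwo E μ ≃ₗ[ℂ] lp E 2 where
  toFun f := ⟨rescale E μ f, (memLp_rescale_iff E μ f).2 f.summable⟩
  map_add' f g := Subtype.ext
    ((rescale E μ).map_add (EllTwo.toSection E μ f) (EllTwo.toSection E μ g))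
  map_smul' c f := Subtype.ext ((rescale E μ).map_smul c (EllTwo.toSection E μ f))
  invFun g := EllTwo.mk E μ (fun x => ((Real.sqrt (μ x) : ℝ) : ℂ)⁻¹ • g x) (by
    rw [← memLp_rescale_iff, rescale_inv]
    exact lp.memℓp g)
  left_inv f := EllTwo.toSection_injective E μ (funext fun x => inv_smul_sqrt_smul E μ x (f x))
  right_inv g := Subtype.ext (rescale_inv E μ g)

theorem inner_toLp (μ : Weight X) (f g : EllTwo E μ) :
    ⟪toLp E μ f, toLp E μ g⟫_ℂ = ⟪f, g⟫_ℂ := by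
  rw [lp.inner_eq_tsum, EllTwo.inner_def]
  refine tsum_congr fun x => ?_
  have h : ((Real.sqrt (μ x) : ℝ) : ℂ) * ((Real.sqrt (μ x) : ℝ) : ℂ) = (μ x : ℂ) := by
    rw [← Complex.ofReal_mul, Real.mul_self_sqrt (μ.pos x).le]
  change ⟪((Real.sqrt (μ x) : ℝ) : ℂ) • f x, ((Real.sqrt (μ x) : ℝ) : ℂ) • g x⟫_ℂ = _
  rw [inner_smul_left, inner_smul_right, Complex.conj_ofReal, ← h]
  ring

/-- The inner product axioms. -/
@[reducible] def innerCore (μ : Weight X) : InnerProductSpace.Core ℂ (EllTwo E μ) where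
  conj_inner_symm f g := by
    rw [← inner_toLp, ← inner_toLp]; exact inner_conj_symm _ _
  re_inner_nonneg f := by
    rw [← inner_toLp]; exact inner_self_nonneg
  add_left f g h := by
    rw [← inner_toLp, ← inner_toLp, ← inner_toLp, map_add, inner_add_left]
  smul_left f g c := by
    rw [← inner_toLp, ← inner_toLp, map_smul, inner_smul_left]
  definite f hf := by
    rw [← inner_toLp, inner_self_eq_zero] at hf
    exact (toLp E μ).map_eq_zero_iff.1 hf

instance (μ : Weight X) : NormedAddCommGroup (EllTwo E μ) :=
  (innerCore E μ).toNormedAddCommGroup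

instance (μ : Weight X) : InnerProductSpace ℂ (EllTwo E μ) :=
  InnerProductSpace.ofCore (innerCore E μ).toCore

/-- `ℓ²(X, μ; E)` is isometric to the unweighted space. -/
def toLpIsometry (μ : Weight X) : EllTwo E μ ≃ₗᵢ[ℂ] lp E 2 :=
  (toLp E μ).isometryOfInner (inner_toLp E μ)

theorem EllTwo.norm_sq (μ : Weight X) (f : EllTwo E μ) : ‖f‖ ^ 2 = ∑' x, ‖f x‖ ^ 2 * μ x := by
  have h := lp.norm_rpow_eq_tsum (p := 2) (by norm_num) (toLpIsometry E μ f)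
  norm_num at h
  rw [h]
  exact tsum_congr fun x => norm_rescale_sq E μ f x

instance (μ : Weight X) [∀ x, CompleteSpace (E x)] : CompleteSpace (EllTwo E μ) :=
  (completeSpace_congr (e := (toLpIsometry E μ).toEquiv)
    (toLpIsometry E μ).isometry.isUniformEmbedding).2 inferInstance

/-- The sections with finite support, as a subspace of `ℓ²(X, μ; E)`. -/
def finSupp (μ : Weight X) : Submodule ℂ (EllTwo E μ) where
  carrier := {f | {x | f x ≠ 0}.Finite}
  add_mem' {f g} hf hg := by
    refine (Set.Finite.union hf hg).subset fun x hx => ?_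
    by_contra h
    simp only [Set.mem_union, Set.mem_ofPred_eq, not_or, not_not] at h
    simp [h.1, h.2] at hx
  zero_mem' := by simp
  smul_mem' c f hf := by
    refine Set.Finite.subset hf fun x hx h => ?_
    simp [h] at hx

/-! ### The formal operator -/

/-- The domain `F_E` of the formal operator. -/
def formalDomain (G : WeightedGraph X) : Submodule ℂ (∀ x, E x) where
  carrier := {f | ∀ x, Summable fun y => G.b x y * ‖f y‖}
  add_mem' {f g} hf hg x := by
    refine Summable.of_nonneg_of_le (fun y => mul_nonneg (G.nonneg x y) (norm_nonneg _))
      (fun y => ?_) ((hf x).add (hg x))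
    rw [← mul_add]
    exact mul_le_mul_of_nonneg_left (norm_add_le _ _) (G.nonneg x y)
  zero_mem' x := by simp
  smul_mem' c f hf x := by
    refine ((hf x).mul_left ‖c‖).congr fun y => ?_
    simp only [Pi.smul_apply, norm_smul]
    ring

variable {E} in
theorem mem_formalDomain_of_finite (G : WeightedGraph X) {f : ∀ x, E x}
    (hf : {x | f x ≠ 0}.Finite) : f ∈ formalDomain E G := fun x =>
  summable_of_hasFiniteSupport (hf.subset fun y hy h => by simp [h] at hy)

section Operator

variable {E} [∀ x, CompleteSpace (E x)]

theorem summable_formal (G : WeightedGraph X) (Φ : UnitaryConnection E)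
    (f : formalDomain E G) (x : X) :
    Summable fun y => (G.b x y : ℂ) • (f.1 x - Φ.map x y (f.1 y)) := by
  refine Summable.of_norm_bounded (((G.summable x).mul_right ‖f.1 x‖).add (f.2 x)) fun y => ?_
  rw [norm_smul, Complex.norm_real, Real.norm_of_nonneg (G.nonneg x y), ← mul_add]
  refine mul_le_mul_of_nonneg_left ((norm_sub_le _ _).trans ?_) (G.nonneg x y)
  rw [LinearIsometryEquiv.norm_map]

/-- The formal magnetic Schrödinger operator `𝓜 : F_E → Γ(X; E)`. -/
def formalOperator (G : WeightedGraph X) (μ : Weight X) (Φ : UnitaryConnection E)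
    (W : SelfAdjointEndomorphism E) : formalDomain E G →ₗ[ℂ] (∀ x, E x) where
  toFun f x :=
    ((1 / μ x : ℝ) : ℂ) • (∑' y, (G.b x y : ℂ) • (f.1 x - Φ.map x y (f.1 y))) + W.map x (f.1 x)
  map_add' f g := by
    ext x
    simp only [Submodule.coe_add, Pi.add_apply, map_add]
    rw [add_add_add_comm, ← smul_add,
      ← (summable_formal G Φ f x).tsum_add (summable_formal G Φ g x)]
    congr 2
    refine tsum_congr fun y => ?_
    rw [← smul_add]
    congr 1
    abel
  map_smul' c f := by
    ext x
    simp only [Pi.smul_apply, RingHom.id_apply, smul_add]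
    rw [smul_comm c, ← (summable_formal G Φ f x).tsum_const_smul]
    congr 2
    · congr 1
      ext y
      rw [smul_comm c]
      simp [smul_sub]
    · simp

/-! ### Realizations -/

/-- The domain of the quadratic form of a lower semi-bounded self-adjoint operator `T`: the
completion, inside the Hilbert space, of the operator domain with respect to the form norm, i.e. the
set of all `f` that are limits of sequences in the operator domain which are Cauchy with respect to
the form `⟪u, T u⟫`. -/
def formDomain {H : Type*} [NormedAddCommGroup H] [InnerProductSpace ℂ H] (T : H →ₗ.[ℂ] H) :
    Set H :=
  {f | ∃ u : ℕ → T.domain, Filter.Tendsto (fun n => (u n : H)) Filter.atTop (𝓝 f) ∧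
    Filter.Tendsto (fun p : ℕ × ℕ => ⟪((u p.1 - u p.2 : T.domain) : H), T (u p.1 - u p.2)⟫_ℂ)
      Filter.atTop (𝓝 0)}

/-- `T` is semi-bounded from below. -/
def LowerSemibounded {H : Type*} [NormedAddCommGroup H] [InnerProductSpace ℂ H]
    (T : H →ₗ.[ℂ] H) : Prop :=
  ∃ C : ℝ, ∀ f : T.domain, C * ‖(f : H)‖ ^ 2 ≤ (⟪(f : H), T f⟫_ℂ).re

/-- `M` is a realization of the formal magnetic Schrödinger operator: a lower semi-bounded
self-adjoint restriction of it whose form domain contains all finitely supported sections. -/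
structure IsRealization (G : WeightedGraph X) (μ : Weight X) (Φ : UnitaryConnection E)
    (W : SelfAdjointEndomorphism E) (M : EllTwo E μ →ₗ.[ℂ] EllTwo E μ) : Prop where
  selfAdjoint : IsSelfAdjoint M
  lowerSemibounded : LowerSemibounded M
  finSupp_subset : (finSupp E μ : Set (EllTwo E μ)) ⊆ formDomain M
  restriction : ∀ f : M.domain, ∃ hf : EllTwo.toSection E μ f ∈ formalDomain E G,
    EllTwo.toSection E μ (M f) = formalOperator G μ Φ W ⟨EllTwo.toSection E μ f, hf⟩

/-! ### The minimal restriction -/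

/-- Under (FC) the formal operator maps finitely supported sections to square-summable ones. -/
theorem summable_formalOperator {G : WeightedGraph X} {μ : Weight X} (hFC : G.FC μ)
    (Φ : UnitaryConnection E) (W : SelfAdjointEndomorphism E) (f : formalDomain E G)
    (hf : {x | f.1 x ≠ 0}.Finite) :
    Summable fun x => ‖formalOperator G μ Φ W f x‖ ^ 2 * μ x := by
  have hs : Summable fun x => (hf.toFinset.card : ℝ) *
      ∑ y ∈ hf.toFinset, (G.b y x / μ x) ^ 2 * μ x * ‖f.1 y‖ ^ 2 :=
    (summable_sum fun y _ => (hFC y).mul_right _).mul_left _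
  refine Summable.of_norm_bounded_eventually hs ?_
  refine hf.subset fun x hx h => hx ?_
  change ‖‖formalOperator G μ Φ W f x‖ ^ 2 * μ x‖ ≤ _
  have e : ∑' y, (G.b x y : ℂ) • (f.1 x - Φ.map x y (f.1 y)) =
      ∑ y ∈ hf.toFinset, (G.b x y : ℂ) • (f.1 x - Φ.map x y (f.1 y)) :=
    tsum_eq_sum fun y hy => by
      have : f.1 y = 0 := by simpa using hy
      simp [h, this]
  have h1 : ‖formalOperator G μ Φ W f x‖ ≤ ∑ y ∈ hf.toFinset, G.b y x / μ x * ‖f.1 y‖ := by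
    change ‖((1 / μ x : ℝ) : ℂ) • ∑' y, (G.b x y : ℂ) • (f.1 x - Φ.map x y (f.1 y)) +
      W.map x (f.1 x)‖ ≤ _
    rw [e, h, map_zero, add_zero, norm_smul, Complex.norm_real, Real.norm_of_nonneg (one_div_nonneg.2 (μ.pos x).le)]
    refine (mul_le_mul_of_nonneg_left (norm_sum_le _ _)
      (one_div_nonneg.2 (μ.pos x).le)).trans (le_of_eq ?_)
    rw [Finset.mul_sum]
    refine Finset.sum_congr rfl fun y _ => ?_
    rw [norm_smul, Complex.norm_real, Real.norm_of_nonneg (G.nonneg x y), zero_sub, norm_neg,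
      LinearIsometryEquiv.norm_map, G.symm x y]
    ring
  rw [Real.norm_of_nonneg (mul_nonneg (sq_nonneg _) (μ.pos x).le)]
  calc ‖formalOperator G μ Φ W f x‖ ^ 2 * μ x
      ≤ (∑ y ∈ hf.toFinset, G.b y x / μ x * ‖f.1 y‖) ^ 2 * μ x := by
        gcongr
        exact (μ.pos x).le
    _ ≤ ((hf.toFinset.card : ℝ) * ∑ y ∈ hf.toFinset, (G.b y x / μ x * ‖f.1 y‖) ^ 2) * μ x := by
        refine mul_le_mul_of_nonneg_right ?_ (μ.pos x).le
        exact sq_sum_le_card_mul_sum_sq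
    _ = _ := by
        rw [mul_assoc, Finset.sum_mul]
        congr 1
        refine Finset.sum_congr rfl fun y _ => ?_
        ring

/-- The minimal restriction of the formal operator, with domain the finitely supported sections;
it is defined if (FC) holds. -/
def minimalOperator {G : WeightedGraph X} {μ : Weight X} (hFC : G.FC μ)
    (Φ : UnitaryConnection E) (W : SelfAdjointEndomorphism E) :
    EllTwo E μ →ₗ.[ℂ] EllTwo E μ where
  domain := finSupp E μ
  toFun :=
    { toFun := fun f => EllTwo.mk E μ
        (formalOperator G μ Φ W ⟨EllTwo.toSection E μ f, mem_formalDomain_of_finite G f.2⟩)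
        (summable_formalOperator hFC Φ W _ f.2)
      map_add' := fun f g => EllTwo.toSection_injective E μ
        ((formalOperator G μ Φ W).map_add
          ⟨EllTwo.toSection E μ f, mem_formalDomain_of_finite G f.2⟩
          ⟨EllTwo.toSection E μ g, mem_formalDomain_of_finite G g.2⟩)
      map_smul' := fun c f => EllTwo.toSection_injective E μ
        ((formalOperator G μ Φ W).map_smul c
          ⟨EllTwo.toSection E μ f, mem_formalDomain_of_finite G f.2⟩) }

/-- `T` is essentially self-adjoint: it is closable and its closure is self-adjoint. -/
def IsEssentiallySelfAdjoint {H : Type*} [NormedAddCommGroup H] [InnerProductSpace ℂ H]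
    [CompleteSpace H] (T : H →ₗ.[ℂ] H) : Prop :=
  T.IsClosable ∧ IsSelfAdjoint T.closure

end Operator

end Bundle

end MagneticSchrodinger

end

/-! Everything rests on one fact: if infinite paths have infinite measure and `W ≥ 0`, then a
section `u` in `ℓ²` and in `F_E` with `𝓜 u = -c u`, `c > 0`, vanishes
(`eq_zero_of_formalOperator_eq_neg`). Pair the equation at a vertex `x` with `u x ≠ 0` against `u
x`: if no neighbour had larger norm, unitarity of `Φ` would make the edge sum nonnegative, while
`-c` and `W ≥ 0` make it negative. So `|u|` strictly increases along some edge out of `x`. Iterating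
yields an infinite path with increasing `|u|`; it is injective, so square-summability of `u` bounds
the total measure of the path, a contradiction.

Uniqueness: two realizations `M`, `N` are bounded below, so `M + c` and `N + c` are onto for large
`c`. If `(M + c) f = (N + c) g`, then `f - g` is a section as above, hence `f = g`, and the
operators agree (`eq_of_shift_injective`).

Existence needs no condition on paths. With `B` a square root of `W`, the form `½ ∑ b(x,y) |f x - Φ
f y|² + ∑ |B f|² μ` equals `‖D f‖²` for a gradient `D`, closed on its maximal domain. The operator
`D⋆D` is self-adjoint (`exists_adjoint_comp_self`), and Green's formula against sections supported
at a point (`inner_gradientOperator_single`) shows that it acts as `𝓜`.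

Essential self-adjointness: a vector orthogonal to the range of `M^min + c` is again a section as
above, so this range is dense. As `M^min` is contained in the realization, its closure is the
realization (`isEssentiallySelfAdjoint_of_le`). -/

noncomputable section

namespace MagneticSchrodinger

universe u v

/-! ### Semi-bounded self-adjoint operators and closed forms on a Hilbert space. -/

section Abstract

variable {H : Type*} [NormedAddCommGroup H] [InnerProductSpace ℂ H]

theorem re_inner_self_eq (f : H) : (⟪f, f⟫_ℂ).re = ‖f‖ ^ 2 :=
  inner_self_eq_norm_sq (𝕜 := ℂ) f

/-- A lower bound for a form gives a lower bound for the shifted operator. -/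
theorem norm_le_of_lowerBound {T : H →ₗ.[ℂ] H} {C c : ℝ}
    (hC : ∀ f : T.domain, C * ‖(f : H)‖ ^ 2 ≤ (⟪(f : H), T f⟫_ℂ).re) (hc : 1 ≤ C + c)
    (f : T.domain) : ‖(f : H)‖ ≤ ‖T f + (c : ℂ) • (f : H)‖ := by
  have h1 : ‖(f : H)‖ ^ 2 ≤ (⟪(f : H), T f + (c : ℂ) • (f : H)⟫_ℂ).re := by
    rw [inner_add_right, inner_smul_right, Complex.add_re, Complex.re_ofReal_mul,
      re_inner_self_eq]
    nlinarith [hC f, sq_nonneg ‖(f : H)‖]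
  have h2 : (⟪(f : H), T f + (c : ℂ) • (f : H)⟫_ℂ).re ≤
      ‖(f : H)‖ * ‖T f + (c : ℂ) • (f : H)‖ := re_inner_le_norm (𝕜 := ℂ) _ _
  rcases (norm_nonneg (f : H)).eq_or_lt with h | h
  · rw [← h]; exact norm_nonneg _
  · refine le_of_mul_le_mul_left ?_ h
    nlinarith

/-- It suffices to check a formal adjoint on a set that spans the domain. -/
theorem isFormalAdjoint_of_span {M T : H →ₗ.[ℂ] H} {s : Set H} (hs : s ⊆ T.domain)
    (hspan : T.domain ≤ Submodule.span ℂ s)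
    (h : ∀ (f : M.domain) (u : H) (hu : u ∈ s), ⟪M f, u⟫_ℂ = ⟪(f : H), T ⟨u, hs hu⟩⟫_ℂ) :
    M.IsFormalAdjoint T := by
  intro f u
  have hle : Submodule.span ℂ s ≤ T.domain := Submodule.span_le.2 hs
  suffices ∀ v (hv : v ∈ Submodule.span ℂ s), ⟪M f, v⟫_ℂ = ⟪(f : H), T ⟨v, hle hv⟩⟫_ℂ from
    this u (hspan u.2)
  intro v hv
  induction hv using Submodule.span_induction with
  | mem v hv => exact h f v hv
  | zero =>
    rw [inner_zero_right, show (⟨0, hle (zero_mem _)⟩ : T.domain) = 0 from rfl, T.map_zero,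
      inner_zero_right]
  | add v w hv hw ihv ihw =>
    rw [inner_add_right, ihv, ihw, ← inner_add_right, ← T.map_add]
    rfl
  | smul c v hv ihv =>
    rw [inner_smul_right, ihv, ← inner_smul_right, ← T.map_smul]
    rfl

variable [CompleteSpace H]

theorem dense_of_inner_eq_zero {S : Submodule ℂ H}
    (h : ∀ x, (∀ v ∈ S, ⟪x, v⟫_ℂ = 0) → x = 0) : Dense (S : Set H) := by
  rw [Submodule.dense_iff_topologicalClosure_eq_top, Submodule.topologicalClosure_eq_top_iff,
    Submodule.eq_bot_iff]
  exact fun x hx => h x ((Submodule.mem_orthogonal' _ _).1 hx)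

/-- A densely defined symmetric operator with a surjective real shift is self-adjoint. -/
theorem isSelfAdjoint_of_surjective {T : H →ₗ.[ℂ] H} (hd : Dense (T.domain : Set H))
    (hs : T.IsFormalAdjoint T) (c : ℝ)
    (hr : ∀ h : H, ∃ f : T.domain, T f + (c : ℂ) • (f : H) = h) : IsSelfAdjoint T := by
  have hle : T ≤ T.adjoint := hs.le_adjoint hd
  rw [LinearPMap.isSelfAdjoint_def]
  refine (LinearPMap.eq_of_le_of_domain_eq hle (le_antisymm hle.1 fun g hg => ?_)).symm
  obtain ⟨h, hh⟩ := hr (T.adjoint ⟨g, hg⟩ + (c : ℂ) • g)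
  suffices g - h = 0 by rw [sub_eq_zero.1 this]; exact h.2
  -- Writing `g - h = (T + c) k` and moving `T + c` to the left factor gives `‖g - h‖² = ⟪(T⋆ + c) g
  -- - (T + c) h, k⟫ = 0`.
  obtain ⟨k, hk⟩ := hr (g - h)
  rw [← inner_self_eq_zero (𝕜 := ℂ)]
  have e1 : ⟪T.adjoint ⟨g, hg⟩, (k : H)⟫_ℂ = ⟪g, T k⟫_ℂ :=
    LinearPMap.adjoint_isFormalAdjoint hd ⟨g, hg⟩ k
  have e2 : ⟪T h, (k : H)⟫_ℂ = ⟪(h : H), T k⟫_ℂ := hs h k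
  have e3 := congrArg (fun z => ⟪z, (k : H)⟫_ℂ) hh
  simp only [inner_add_left, inner_smul_left, Complex.conj_ofReal] at e3
  nth_rewrite 2 [← hk]
  rw [inner_sub_left, inner_add_right, inner_add_right, inner_smul_right, inner_smul_right,
    ← e1, ← e2]
  linear_combination -e3

/-- The lower bound makes `T + c` bounded below on the complete graph of `T`, so its range is
closed. A vector orthogonal to the range lies in the kernel of `T⋆ + c = T + c`, which the same
bound makes trivial. -/
theorem surjective_of_isSelfAdjoint {T : H →ₗ.[ℂ] H} (hT : IsSelfAdjoint T) {C c : ℝ}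
    (hC : ∀ f : T.domain, C * ‖(f : H)‖ ^ 2 ≤ (⟪(f : H), T f⟫_ℂ).re) (hc : 1 ≤ C + c) (h : H) :
    ∃ f : T.domain, T f + (c : ℂ) • (f : H) = h := by
  have hclosed : IsClosed (T.graph : Set (H × H)) := hT.isClosed
  have : CompleteSpace T.graph := hclosed.completeSpace_coe
  let S : T.graph →L[ℂ] H :=
    ((ContinuousLinearMap.snd ℂ H H) + (c : ℂ) • (ContinuousLinearMap.fst ℂ H H)) ∘L
      T.graph.subtypeL
  have hS : ∀ p : T.graph, S p = (p : H × H).2 + (c : ℂ) • (p : H × H).1 := fun p => rfl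
  -- The graph carries the maximum norm: `‖f‖ ≤ ‖S p‖` and `‖T f‖ ≤ (1 + |c|) ‖S p‖`, so the
  -- constant has room to spare.
  have hbound : ∀ p : T.graph, ‖p‖ ≤ ((2 + ‖(c : ℂ)‖₊ : NNReal) : ℝ) * ‖S p‖ := by
    rintro ⟨⟨p, q⟩, hp⟩
    obtain ⟨f, rfl, rfl⟩ := T.mem_graph_iff.1 hp
    rw [hS]
    have h1 := norm_le_of_lowerBound hC hc f
    have h2 : ‖T f‖ ≤ ‖T f + (c : ℂ) • (f : H)‖ + ‖(c : ℂ)‖ * ‖(f : H)‖ := by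
      rw [← norm_smul]
      exact norm_le_add_norm_add _ _
    have h3 := norm_nonneg (c : ℂ)
    have h4 := norm_nonneg (T f + (c : ℂ) • (f : H))
    have h5 := mul_le_mul_of_nonneg_left h1 h3
    have h6 := mul_nonneg h3 h4
    refine max_le (?_ : ‖(f : H)‖ ≤ _) (?_ : ‖T f‖ ≤ _) <;> push_cast <;> linarith
  have hrange : IsClosed (Set.range S) :=
    (S.antilipschitz_of_bound hbound).isClosed_range S.uniformContinuous
  have htop : S.range = ⊤ := by
    have hd : Dense (S.range : Set H) := dense_of_inner_eq_zero fun g hg => by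
      have hg' : ∀ f : T.domain, ⟪-((c : ℂ) • g), (f : H)⟫_ℂ = ⟪g, T f⟫_ℂ := fun f => by
        have := hg _ ⟨⟨_, T.mem_graph f⟩, hS _⟩
        simp only [inner_add_right, inner_smul_right] at this
        rw [inner_neg_left, inner_smul_left, Complex.conj_ofReal]
        linear_combination -this
      have hmem : g ∈ T.domain := by
        rw [← LinearPMap.isSelfAdjoint_def.1 hT]
        exact T.mem_adjoint_domain_of_exists g ⟨_, hg'⟩
      have hTg : T ⟨g, hmem⟩ = -((c : ℂ) • g) := by
        have h1 : T.adjoint ≤ T := (LinearPMap.isSelfAdjoint_def.1 hT).le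
        rw [← LinearPMap.adjoint_apply_eq hT.dense_domain
          ⟨g, T.mem_adjoint_domain_of_exists g ⟨_, hg'⟩⟩ hg']
        exact (h1.2 rfl).symm
      have := norm_le_of_lowerBound hC hc ⟨g, hmem⟩
      rw [hTg] at this
      simpa using this
    have hcl : IsClosed (S.range : Set H) := hrange
    exact SetLike.coe_injective (hcl.closure_eq.symm.trans hd.closure_eq)
  obtain ⟨⟨⟨p, q⟩, hp⟩, hpS⟩ := LinearMap.range_eq_top.1 htop h
  obtain ⟨f, rfl, rfl⟩ := T.mem_graph_iff.1 hp
  exact ⟨f, hpS⟩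

/-- Self-adjoint operators bounded below agree if their resolvents do. -/
theorem eq_of_shift_injective {M N : H →ₗ.[ℂ] H} (hM : IsSelfAdjoint M) (hN : IsSelfAdjoint N)
    (hMC : LowerSemibounded M) (hNC : LowerSemibounded N)
    (h : ∀ c : ℝ, 0 < c → ∀ (f : M.domain) (g : N.domain),
      M f + (c : ℂ) • (f : H) = N g + (c : ℂ) • (g : H) → (f : H) = g) : M = N := by
  have key : ∀ {M N : H →ₗ.[ℂ] H}, IsSelfAdjoint N → LowerSemibounded N →
      (∀ c : ℝ, 0 < c → ∀ (f : M.domain) (g : N.domain),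
        M f + (c : ℂ) • (f : H) = N g + (c : ℂ) • (g : H) → (f : H) = g) → M ≤ N := by
    intro M N hN ⟨C, hC⟩ h
    have key' : ∀ f : M.domain, ∃ g : N.domain, (f : H) = g ∧ M f = N g := fun f => by
      have hc : 1 ≤ C + (1 + |C|) := by linarith [neg_abs_le C]
      obtain ⟨g, hg⟩ := surjective_of_isSelfAdjoint hN hC hc (M f + ((1 + |C| : ℝ) : ℂ) • (f : H))
      have e := h (1 + |C|) (by positivity) f g hg.symm
      rw [e] at hg
      exact ⟨g, e, (add_right_cancel hg).symm⟩
    refine ⟨fun f hf => ?_, fun f g hfg => ?_⟩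
    · obtain ⟨g, e, -⟩ := key' ⟨f, hf⟩
      exact (show f = g from e) ▸ g.2
    · obtain ⟨g', e, e'⟩ := key' f
      rw [e']
      congr 1
      exact Subtype.ext (e.symm.trans hfg)
  exact le_antisymm (key hN hNC h) (key hM hMC fun c hc f g e => (h c hc g f e.symm).symm)

/-- A restriction of a self-adjoint semibounded operator whose shift has dense range is essentially
self-adjoint. -/
theorem isEssentiallySelfAdjoint_of_le {T M : H →ₗ.[ℂ] H} (hM : IsSelfAdjoint M) (hTM : T ≤ M)
    {C c : ℝ} (hC : ∀ f : M.domain, C * ‖(f : H)‖ ^ 2 ≤ (⟪(f : H), M f⟫_ℂ).re) (hc : 1 ≤ C + c)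
    (hr : Dense (Set.range fun f : T.domain => T f + (c : ℂ) • (f : H))) :
    IsEssentiallySelfAdjoint T := by
  have hMcl := hM.isClosed
  have hT : T.IsClosable := hMcl.isClosable.leIsClosable hTM
  refine ⟨hT, ?_⟩
  suffices T.closure = M by rwa [this]
  refine LinearPMap.eq_of_eq_graph (le_antisymm ?_ ?_)
  · rw [← hT.graph_closure_eq_closure_graph]
    exact Submodule.topologicalClosure_minimal _ (LinearPMap.le_graph_of_le hTM) hMcl
  · rintro ⟨p, q⟩ hp
    obtain ⟨f, rfl, rfl⟩ := M.mem_graph_iff.1 hp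
    rw [← hT.graph_closure_eq_closure_graph]
    -- Convergence of `(T + c) v n` to `(M + c) f` forces `v n → f` by the lower bound for `M + c`,
    -- and then `T (v n) → M f`: the graph of `T` is dense in that of `M`.
    obtain ⟨u, hu, hlim⟩ := mem_closure_iff_seq_limit.1 (hr (M f + (c : ℂ) • (f : H)))
    choose v hv using hu
    let w : ℕ → M.domain := fun n => ⟨v n, hTM.1 (v n).2⟩
    have hw : ∀ n, T (v n) = M (w n) := fun n => hTM.2 rfl
    have h1 : Filter.Tendsto (fun n => (v n : H)) Filter.atTop (𝓝 f) := by
      rw [tendsto_iff_norm_sub_tendsto_zero] at hlim ⊢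
      refine squeeze_zero (fun _ => norm_nonneg _) (fun n => ?_) hlim
      have := norm_le_of_lowerBound hC hc (w n - f)
      rw [← hv n]
      beta_reduce
      rw [hw]
      refine this.trans_eq (congrArg _ ?_)
      rw [M.map_sub, Submodule.coe_sub, smul_sub]
      abel
    have h2 : Filter.Tendsto (fun n => T (v n)) Filter.atTop (𝓝 (M f)) := by
      have := hlim.sub (h1.const_smul (c : ℂ))
      simpa [← hv] using this
    exact mem_closure_of_tendsto (h1.prodMk_nhds h2)
      (Filter.Eventually.of_forall fun n => T.mem_graph (v n))

/-- The self-adjoint operator of a closed form, the form being given as a Hilbert space `V` embedded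
in `H`, with inner product the form plus the inner product of `H`. -/
theorem exists_formOperator {V : Type*} [NormedAddCommGroup V] [InnerProductSpace ℂ V]
    [CompleteSpace V] (ι : V →L[ℂ] H) (hι : Function.Injective ι) (hd : DenseRange ι) :
    ∃ M : H →ₗ.[ℂ] H, IsSelfAdjoint M ∧ LowerSemibounded M ∧ Set.range ι ⊆ formDomain M ∧
      ∀ f : M.domain, ∃ v : V, ι v = f ∧ ∀ u : V, ⟪M f, ι u⟫_ℂ + ⟪(f : H), ι u⟫_ℂ = ⟪v, u⟫_ℂ := by
  -- `A w` is the Riesz representative in `V` of the functional given by `w`, that is, the weak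
  -- solution of `(M + 1) f = w`. Hence `ι A` has to be the resolvent, and `M` is defined as its
  -- inverse minus the identity.
  let A := ι.adjoint
  let R : H →ₗ[ℂ] H := (ι ∘L A : H →L[ℂ] H)
  have hRw : ∀ w, R w = ι (A w) := fun w => rfl
  have hA : ∀ w v, ⟪A w, v⟫_ℂ = ⟪w, ι v⟫_ℂ := fun w v => ι.adjoint_inner_left v w
  have hA' : ∀ v w, ⟪v, A w⟫_ℂ = ⟪ι v, w⟫_ℂ := fun v w => ι.adjoint_inner_right v w
  have hAinj : ∀ w, A w = 0 → w = 0 := fun w hw =>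
    hd.eq_zero_of_inner_left ℂ fun v => by
      rw [← hA, hw, inner_zero_left]
  have hR : Function.Injective R := by
    rw [← LinearMap.ker_eq_bot, LinearMap.ker_eq_bot']
    intro w hw
    exact hAinj w (hι (by rw [← hRw, hw, map_zero]))
  let e := LinearEquiv.ofInjective R hR
  let M : H →ₗ.[ℂ] H := ⟨LinearMap.range R, e.symm.toLinearMap - (LinearMap.range R).subtype⟩
  have hM : ∀ f : M.domain, ∃ w, (f : H) = ι (A w) ∧ M f = w - ι (A w) := by
    intro f
    obtain ⟨w, rfl⟩ := e.surjective f
    refine ⟨w, rfl, ?_⟩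
    change e.symm (e w) - _ = _
    rw [e.symm_apply_apply]
    rfl
  have hM' : ∀ w, ∃ f : M.domain, (f : H) = ι (A w) ∧ M f = w - ι (A w) := by
    intro w
    refine ⟨e w, rfl, ?_⟩
    change e.symm (e w) - _ = _
    rw [e.symm_apply_apply]
    rfl
  have hAdense : Dense (A.range : Set V) := dense_of_inner_eq_zero fun v hv => by
    have := hv _ ⟨ι v, rfl⟩
    rw [← inner_conj_symm] at this
    erw [hA] at this
    rw [inner_conj_symm, inner_self_eq_zero] at this
    exact hι (this.trans ι.map_zero.symm)
  have hform : ∀ f : M.domain, ∃ v : V, ι v = f ∧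
      ∀ u : V, ⟪M f, ι u⟫_ℂ + ⟪(f : H), ι u⟫_ℂ = ⟪v, u⟫_ℂ := by
    intro f
    obtain ⟨w, h1, h2⟩ := hM f
    refine ⟨A w, h1.symm, fun u => ?_⟩
    rw [h2, h1, inner_sub_left, sub_add_cancel, hA]
  -- The inner product of `V` is the form plus that of `H`, so the form is `‖v‖² - ‖ι v‖² ≥ -‖ι
  -- v‖²`.
  refine ⟨M, ?_, ⟨-1, fun f => ?_⟩, ?_, hform⟩
  · refine isSelfAdjoint_of_surjective ?_ ?_ 1 ?_
    · have : DenseRange (ι ∘ A) := hd.comp hAdense ι.continuous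
      exact this
    · intro f g
      obtain ⟨w, h1, h2⟩ := hM f
      obtain ⟨w', h1', h2'⟩ := hM g
      rw [h2, h1, h2', h1', inner_sub_left, inner_sub_right, ← hA, ← hA', hA']
    · intro h
      obtain ⟨f, h1, h2⟩ := hM' h
      exact ⟨f, by rw [h1, h2]; simp⟩
  · obtain ⟨v, rfl', h⟩ := hform f
    have := congrArg Complex.re (h v)
    rw [rfl', Complex.add_re, re_inner_self_eq, re_inner_self_eq] at this
    rw [← inner_conj_symm, Complex.conj_re]
    nlinarith [sq_nonneg ‖v‖]
  · rintro _ ⟨v, rfl⟩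
    obtain ⟨u, hu, hlim⟩ := mem_closure_iff_seq_limit.1 (hAdense v)
    choose w hw using hu
    choose f hf1 hf2 using fun n => hM' (w n)
    have hlim' : Filter.Tendsto (fun n => A (w n)) Filter.atTop (𝓝 v) := hlim.congr fun n => (hw n).symm
    have h0 : Filter.Tendsto (fun p : ℕ × ℕ => A (w p.1) - A (w p.2)) Filter.atTop (𝓝 0) := by
      rw [← sub_self v, ← Filter.prod_atTop_atTop_eq]
      exact (hlim'.comp Filter.tendsto_fst).sub (hlim'.comp Filter.tendsto_snd)
    refine ⟨f, ?_, ?_⟩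
    · simp only [hf1]
      exact (ι.continuous.tendsto v).comp hlim'
    -- The form of `M` at a difference of approximants is its squared norm in `V` minus its squared
    -- norm in `H`; both tend to `0`.
    · have h1 := h0.inner h0 (𝕜 := ℂ)
      have h2 := ((ι.continuous.tendsto 0).comp h0).inner ((ι.continuous.tendsto 0).comp h0) (𝕜 := ℂ)
      have h3 := h1.sub h2
      simp only [map_zero, inner_zero_left, sub_zero] at h3
      refine h3.congr fun p => ?_
      simp only [Function.comp_apply, Submodule.coe_sub, LinearPMap.map_sub, hf1, hf2, map_sub]
      rw [← map_sub A (w p.1) (w p.2), hA', sub_sub_sub_comm (w p.1)]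
      simp only [map_sub, inner_sub_right]

/-- The self-adjoint operator `D⋆D` of a densely defined closed operator `D`. -/
theorem exists_adjoint_comp_self {K : Type*} [NormedAddCommGroup K] [InnerProductSpace ℂ K]
    [CompleteSpace K] (D : H →ₗ.[ℂ] K) (hD : D.IsClosed) (hd : Dense (D.domain : Set H)) :
    ∃ M : H →ₗ.[ℂ] H, IsSelfAdjoint M ∧ LowerSemibounded M ∧ (D.domain : Set H) ⊆ formDomain M ∧
      ∀ f : M.domain, ∃ g : D.domain, (g : H) = f ∧
        ∀ u : D.domain, ⟪M f, (u : H)⟫_ℂ = ⟪D g, D u⟫_ℂ := by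
  -- The form Hilbert space is the graph of `D` with the Euclidean product norm, so that its inner
  -- product is `⟪D g, D u⟫ + ⟪g, u⟫`.
  let V : Submodule ℂ (WithLp 2 (H × K)) :=
    D.graph.comap (WithLp.linearEquiv 2 ℂ (H × K)).toLinearMap
  have hV : IsClosed (V : Set (WithLp 2 (H × K))) :=
    hD.preimage (WithLp.prod_continuous_ofLp 2 H K)
  have : CompleteSpace V := hV.completeSpace_coe
  let ι : V →L[ℂ] H := WithLp.fstL 2 ℂ H K ∘L V.subtypeL
  have hmem : ∀ v : V, ∃ g : D.domain, (g : H) = ι v ∧ D g = (v : WithLp 2 (H × K)).snd :=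
    fun v => D.mem_graph_iff.1 v.2
  have hmem' : ∀ g : D.domain, ∃ v : V, ι v = g ∧ (v : WithLp 2 (H × K)).snd = D g :=
    fun g => ⟨⟨WithLp.toLp 2 ((g : H), D g), D.mem_graph g⟩, rfl, rfl⟩
  have hrange : Set.range ι = D.domain := by
    ext f
    constructor
    · rintro ⟨v, rfl⟩
      obtain ⟨g, hg, -⟩ := hmem v
      exact hg ▸ g.2
    · intro hf
      obtain ⟨v, hv, -⟩ := hmem' ⟨f, hf⟩
      exact ⟨v, hv⟩
  have hinj : Function.Injective ι := by
    refine (injective_iff_map_eq_zero ι).2 fun v hv => ?_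
    obtain ⟨g, hg, hg'⟩ := hmem v
    have hg0 : g = 0 := Subtype.ext (hg.trans hv)
    rw [hg0, D.map_zero] at hg'
    refine Subtype.ext (WithLp.ofLp_injective 2 (Prod.ext hv hg'.symm))
  obtain ⟨M, h1, h2, h3, h4⟩ := exists_formOperator ι hinj (by rw [DenseRange, hrange]; exact hd)
  refine ⟨M, h1, h2, hrange ▸ h3, fun f => ?_⟩
  obtain ⟨v, hv, hvf⟩ := h4 f
  obtain ⟨g, hg, hg'⟩ := hmem v
  refine ⟨g, hg.trans hv, fun u => ?_⟩
  obtain ⟨w, hw, hw'⟩ := hmem' u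
  have := hvf w
  rw [Submodule.coe_inner, WithLp.prod_inner_apply, ← hv, hw] at this
  change _ + _ = ⟪ι v, ι w⟫_ℂ + ⟪(v : WithLp 2 (H × K)).snd, (w : WithLp 2 (H × K)).snd⟫_ℂ at this
  rw [hw, ← hg', hw', add_comm] at this
  exact add_left_cancel this

end Abstract

/-! ### Sections supported at one point, and density of the finitely supported ones. -/

section Sections

variable {X : Type u} {E : X → Type v} [∀ x, NormedAddCommGroup (E x)]
  [∀ x, InnerProductSpace ℂ (E x)] {μ : Weight X}

theorem continuous_toSection_apply (x : X) : Continuous fun f : EllTwo E μ => f x := by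
  have h : (fun f : EllTwo E μ => f x) =
      fun f => ((Real.sqrt (μ x) : ℝ) : ℂ)⁻¹ • toLpIsometry E μ f x :=
    funext fun f => (inv_smul_sqrt_smul E μ x (f x)).symm
  rw [h]
  exact ((lp.evalCLM ℂ E 2 x).continuous.comp (toLpIsometry E μ).continuous).const_smul _

open Classical in
/-- The section supported at a single point. -/
def EllTwo.single (μ : Weight X) (x : X) (ξ : E x) : EllTwo E μ :=
  EllTwo.mk E μ (Pi.single x ξ) (summable_of_hasFiniteSupport
    ((Set.finite_singleton x).subset fun y hy => by
      by_contra h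
      simp [Pi.single_eq_of_ne h] at hy))

open Classical in
theorem EllTwo.toSection_single (x : X) (ξ : E x) :
    EllTwo.toSection E μ (EllTwo.single μ x ξ) = Pi.single x ξ := rfl

theorem EllTwo.single_apply_self (x : X) (ξ : E x) : EllTwo.single μ x ξ x = ξ := by
  classical
  rw [toSection_single, Pi.single_eq_same]

theorem EllTwo.single_apply_of_ne {x y : X} (h : y ≠ x) (ξ : E x) :
    EllTwo.single μ x ξ y = 0 := by
  classical
  rw [toSection_single, Pi.single_eq_of_ne h]

theorem EllTwo.single_mem_finSupp (x : X) (ξ : E x) : EllTwo.single μ x ξ ∈ finSupp E μ :=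
  (Set.finite_singleton x).subset fun _ hy => by
    by_contra h
    exact hy (single_apply_of_ne h ξ)

theorem EllTwo.inner_single_right (f : EllTwo E μ) (x : X) (ξ : E x) :
    ⟪f, EllTwo.single μ x ξ⟫_ℂ = ⟪f x, ξ⟫_ℂ * μ x := by
  rw [inner_def, tsum_eq_single x, single_apply_self]
  intro y hy
  rw [single_apply_of_ne hy, inner_zero_right, zero_mul]

/-- Finitely supported sections are linear combinations of sections supported at a point. -/
theorem finSupp_le_of_single_mem {S : Submodule ℂ (EllTwo E μ)}
    (h : ∀ x (ξ : E x), EllTwo.single μ x ξ ∈ S) : finSupp E μ ≤ S := by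
  classical
  intro f hf
  have hf : {x | f x ≠ 0}.Finite := hf
  have e : f = ∑ x ∈ hf.toFinset, EllTwo.single μ x (f x) := by
    refine EllTwo.toSection_injective E μ (funext fun y => ?_)
    rw [map_sum, Finset.sum_apply]
    by_cases hy : f y = 0
    · rw [hy, Finset.sum_eq_zero]
      intro x hx
      refine EllTwo.single_apply_of_ne ?_ _
      rintro rfl
      simp [hy] at hx
    · rw [Finset.sum_eq_single y, EllTwo.single_apply_self]
      · exact fun x _ hx => EllTwo.single_apply_of_ne hx.symm _
      · simp [hy]
  rw [e]
  exact sum_mem fun x _ => h x _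

theorem dense_of_single_mem [∀ x, CompleteSpace (E x)] {S : Submodule ℂ (EllTwo E μ)}
    (h : ∀ x (ξ : E x), EllTwo.single μ x ξ ∈ S) : Dense (S : Set (EllTwo E μ)) :=
  dense_of_inner_eq_zero fun f hf => EllTwo.toSection_injective E μ <| funext fun x => by
    have := hf _ (h x (f x))
    rw [EllTwo.inner_single_right, mul_eq_zero, inner_self_eq_zero] at this
    exact this.resolve_right (Complex.ofReal_ne_zero.2 (μ.pos x).ne')

theorem UnitaryConnection.inner_map_left (Φ : UnitaryConnection E) {x y : X} (ξ : E y) (η : E x) :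
    ⟪Φ.map x y ξ, η⟫_ℂ = ⟪ξ, Φ.map y x η⟫_ℂ := by
  rw [Φ.symm y x]
  exact LinearIsometryEquiv.inner_map_eq_flip _ _ _

theorem UnitaryConnection.inner_map_map (Φ : UnitaryConnection E) {x y : X} (ξ η : E y) :
    ⟪Φ.map x y ξ, Φ.map x y η⟫_ℂ = ⟪ξ, η⟫_ℂ :=
  LinearIsometryEquiv.inner_map_map _ _ _

/-- Under (FC) square-summable sections are in the domain of the formal operator. -/
theorem mem_formalDomain_of_FC {G : WeightedGraph X} (hFC : G.FC μ) (f : EllTwo E μ) :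
    EllTwo.toSection E μ f ∈ formalDomain E G := by
  intro x
  refine Summable.of_nonneg_of_le (fun y => mul_nonneg (G.nonneg x y) (norm_nonneg _))
    (fun y => ?_) ((hFC x).add f.summable)
  have hμ := μ.pos y
  have e : G.b x y * ‖f y‖ = G.b x y / μ y * ‖f y‖ * μ y := by field_simp
  rw [e, ← add_mul]
  refine mul_le_mul_of_nonneg_right ?_ hμ.le
  nlinarith [sq_nonneg (G.b x y / μ y - ‖f y‖), sq_nonneg (G.b x y / μ y), sq_nonneg ‖f y‖]

end Sections

/-! ### Growth of eigensections along paths, and uniqueness of the realization. -/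

section Operator

variable {X : Type u} {E : X → Type v} [∀ x, NormedAddCommGroup (E x)]
  [∀ x, InnerProductSpace ℂ (E x)] [∀ x, CompleteSpace (E x)]
  {G : WeightedGraph X} {μ : Weight X} {Φ : UnitaryConnection E} {W : SelfAdjointEndomorphism E}

/-- The weak form of `𝓜` at one vertex, with the potential moved to the value of the sum. Both the
growth argument and the Green formulas start from it. -/
theorem hasSum_inner_formalOperator (f : formalDomain E G) (x : X) (ξ : E x) :
    HasSum (fun y => (G.b x y : ℂ) * ⟪f.1 x - Φ.map x y (f.1 y), ξ⟫_ℂ)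
      (⟪formalOperator G μ Φ W f x, ξ⟫_ℂ * μ x - ⟪W.map x (f.1 x), ξ⟫_ℂ * μ x) := by
  have h := (innerSLFlip ℂ ξ).hasSum (summable_formal G Φ f x).hasSum
  simp only [innerSLFlip_apply_apply, inner_smul_left, Complex.conj_ofReal] at h
  convert! h using 1
  have hμ : (μ x : ℂ) ≠ 0 := Complex.ofReal_ne_zero.2 (μ.pos x).ne'
  change ⟪((1 / μ x : ℝ) : ℂ) • (∑' y, (G.b x y : ℂ) • (f.1 x - Φ.map x y (f.1 y))) +
    W.map x (f.1 x), ξ⟫_ℂ * μ x - _ = _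
  rw [inner_add_left, inner_smul_left, Complex.conj_ofReal]
  push_cast
  field_simp
  ring

/-- An eigensection to a negative eigenvalue increases along some edge out of every point of its
support. -/
theorem exists_adj_norm_lt (hW : W.Nonneg) (f : formalDomain E G) {c : ℝ} (hc : 0 < c)
    (hf : ∀ x, formalOperator G μ Φ W f x = -((c : ℂ) • f.1 x)) {x : X} (hx : f.1 x ≠ 0) :
    ∃ y, G.Adj x y ∧ ‖f.1 x‖ < ‖f.1 y‖ := by
  by_contra! hcon
  have h := Complex.hasSum_re (hasSum_inner_formalOperator (μ := μ) (Φ := Φ) (W := W) f x (f.1 x))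
  have hnn : 0 ≤ (⟪formalOperator G μ Φ W f x, f.1 x⟫_ℂ * μ x -
      ⟪W.map x (f.1 x), f.1 x⟫_ℂ * μ x).re := by
    refine h.nonneg fun y => ?_
    rw [Complex.re_ofReal_mul, inner_sub_left, Complex.sub_re, re_inner_self_eq]
    rcases (G.nonneg x y).eq_or_lt with h0 | h0
    · rw [← h0, zero_mul]
    · refine mul_nonneg h0.le (sub_nonneg.2 ?_)
      refine (re_inner_le_norm (𝕜 := ℂ) _ _).trans ?_
      rw [LinearIsometryEquiv.norm_map, sq]
      exact mul_le_mul_of_nonneg_right (hcon y h0) (norm_nonneg _)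
  rw [hf, inner_neg_left, inner_smul_left, Complex.conj_ofReal, Complex.sub_re,
    Complex.re_mul_ofReal, Complex.re_mul_ofReal, Complex.neg_re, Complex.re_ofReal_mul,
    re_inner_self_eq] at hnn
  have h1 : 0 < c * ‖f.1 x‖ ^ 2 * μ x :=
    mul_pos (mul_pos hc (pow_pos (norm_pos_iff.2 hx) 2)) (μ.pos x)
  have h2 := mul_nonneg (hW x (f.1 x)) (μ.pos x).le
  linarith

/-- The formal operator has no square-summable eigensections to negative eigenvalues if infinite
paths have infinite measure. -/
theorem eq_zero_of_formalOperator_eq_neg (hG : G.InfinitePathsHaveInfiniteMeasure μ)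
    (hW : W.Nonneg) (f : EllTwo E μ) (hfd : EllTwo.toSection E μ f ∈ formalDomain E G) {c : ℝ}
    (hc : 0 < c)
    (hf : ∀ x, formalOperator G μ Φ W ⟨EllTwo.toSection E μ f, hfd⟩ x = -((c : ℂ) • f x)) :
    f = 0 := by
  by_contra hne
  obtain ⟨x₀, hx₀⟩ : ∃ x, f x ≠ 0 := by
    by_contra! h
    exact hne (EllTwo.toSection_injective E μ (funext h))
  have hnext : ∀ x : {x // f x ≠ 0}, ∃ y : {x // f x ≠ 0},
      G.Adj x y ∧ ‖f x‖ < ‖f y‖ := fun x => by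
    obtain ⟨y, h1, h2⟩ := exists_adj_norm_lt hW _ hc hf x.2
    exact ⟨⟨y, norm_pos_iff.1 ((norm_nonneg _).trans_lt h2)⟩, h1, h2⟩
  choose next hadj hlt using hnext
  let p : ℕ → {x // f x ≠ 0} := fun n => next^[n] ⟨x₀, hx₀⟩
  have hp : ∀ n, p (n + 1) = next (p n) := fun n => Function.iterate_succ_apply' _ _ _
  have hmono : StrictMono fun n => ‖f (p n)‖ := strictMono_nat_of_lt_succ fun n => by
    rw [hp]; exact hlt _
  -- Paths may revisit vertices in general; strict growth of the norm excludes this here, so the sum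
  -- over the path is a subsum of the `ℓ²` sum.
  have hinj : Function.Injective fun n => (p n : X) := fun m n hmn =>
    hmono.injective (show ‖f (p m)‖ = ‖f (p n)‖ by
      have : p m = p n := Subtype.ext hmn
      rw [this])
  have hs : Summable fun n => ‖f (p n)‖ ^ 2 * μ (p n) := f.summable.comp_injective hinj
  have h0 : 0 < ‖f x₀‖ ^ 2 := pow_pos (norm_pos_iff.2 hx₀) 2
  have hμ : Summable fun n => μ (p n) := by
    refine Summable.of_nonneg_of_le (fun n => (μ.pos _).le) (fun n => ?_)
      (hs.mul_left (‖f x₀‖ ^ 2)⁻¹)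
    rw [← mul_assoc, ← div_eq_inv_mul]
    refine le_mul_of_one_le_left (μ.pos _).le ((one_le_div h0).2 ?_)
    exact pow_le_pow_left₀ (norm_nonneg _) (hmono.monotone (Nat.zero_le n)) 2
  exact hμ.tsum_ofReal_ne_top (hG (fun n => p n) fun n => by
    have := hadj (p n)
    rwa [← hp] at this)

/-- If `(M + c) f = (N + c) g`, both operators being restrictions of `𝓜` gives `𝓜 (f - g) = -c (f -
g)`, so `f = g`. -/
theorem IsRealization.unique (hG : G.InfinitePathsHaveInfiniteMeasure μ) (hW : W.Nonneg)
    {M N : EllTwo E μ →ₗ.[ℂ] EllTwo E μ} (hM : IsRealization G μ Φ W M)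
    (hN : IsRealization G μ Φ W N) : M = N := by
  refine eq_of_shift_injective hM.selfAdjoint hN.selfAdjoint hM.lowerSemibounded
    hN.lowerSemibounded fun c hc f g hfg => ?_
  obtain ⟨hf, hMf⟩ := hM.restriction f
  obtain ⟨hg, hNg⟩ := hN.restriction g
  rw [← sub_eq_zero]
  have hd : EllTwo.toSection E μ ((f : EllTwo E μ) - g) ∈ formalDomain E G := by
    rw [map_sub]; exact sub_mem hf hg
  refine eq_zero_of_formalOperator_eq_neg (Φ := Φ) hG hW _ hd hc fun x => ?_
  have e : formalOperator G μ Φ W ⟨EllTwo.toSection E μ ((f : EllTwo E μ) - g), hd⟩ =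
      EllTwo.toSection E μ (M f - N g) := by
    rw [LinearMap.map_sub _ (M f), hMf, hNg, ← map_sub]
    congr 1
  have e' : M f - N g = -((c : ℂ) • ((f : EllTwo E μ) - g)) := by
    rw [smul_sub, neg_sub, sub_eq_sub_iff_add_eq_add, hfg, add_comm]
  rw [e, e']
  simp only [map_neg, map_smul, Pi.neg_apply, Pi.smul_apply]

end Operator

/-! ### The magnetic gradient, Green's formula and existence of a realization. -/

section Form

variable {X : Type u} {E : X → Type v} [∀ x, NormedAddCommGroup (E x)]
  [∀ x, InnerProductSpace ℂ (E x)] {G : WeightedGraph X} {μ : Weight X}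
  {Φ : UnitaryConnection E} {B : ∀ x, E x →L[ℂ] E x}

/-- The magnetic gradient on the edges `(x, some y)`, together with the potential, with square root
`B`, on the vertices `(x, none)`. -/
def gradient (G : WeightedGraph X) (μ : Weight X) (Φ : UnitaryConnection E)
    (B : ∀ x, E x →L[ℂ] E x) : (∀ x, E x) →ₗ[ℂ] (∀ p : X × Option X, E p.1) where
  toFun f p := match p with
    | (x, none) => ((Real.sqrt (μ x) : ℝ) : ℂ) • B x (f x)
    | (x, some y) => ((Real.sqrt (G.b x y / 2) : ℝ) : ℂ) • (f x - Φ.map x y (f y))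
  map_add' f g := by
    funext ⟨x, o⟩
    cases o
    · simp
    · simp only [Pi.add_apply, map_add, ← smul_add]
      congr 1
      abel
  map_smul' c f := by
    funext ⟨x, o⟩
    cases o
    · simp [smul_comm c]
    · simp [smul_sub, smul_comm c]

theorem gradient_none (f : ∀ x, E x) (x : X) : gradient G μ Φ B f (x, none) =
    ((Real.sqrt (μ x) : ℝ) : ℂ) • B x (f x) := rfl

theorem gradient_some (f : ∀ x, E x) (x y : X) : gradient G μ Φ B f (x, some y) =
    ((Real.sqrt (G.b x y / 2) : ℝ) : ℂ) • (f x - Φ.map x y (f y)) := rfl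

theorem norm_gradient_some_sq (f : ∀ x, E x) (x y : X) : ‖gradient G μ Φ B f (x, some y)‖ ^ 2 =
    G.b x y / 2 * ‖f x - Φ.map x y (f y)‖ ^ 2 := by
  rw [gradient_some, norm_smul, mul_pow, Complex.norm_real,
    Real.norm_of_nonneg (Real.sqrt_nonneg _), Real.sq_sqrt (div_nonneg (G.nonneg x y) zero_le_two)]

theorem inner_gradient_some (f g : ∀ x, E x) (x y : X) :
    ⟪gradient G μ Φ B f (x, some y), gradient G μ Φ B g (x, some y)⟫_ℂ =
      (G.b x y : ℂ) / 2 * ⟪f x - Φ.map x y (f y), g x - Φ.map x y (g y)⟫_ℂ := by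
  rw [gradient_some, gradient_some, inner_smul_left, inner_smul_right, Complex.conj_ofReal,
    ← mul_assoc, ← Complex.ofReal_mul,
    Real.mul_self_sqrt (div_nonneg (G.nonneg x y) zero_le_two)]
  push_cast
  rfl

theorem inner_gradient_none (f g : ∀ x, E x) (x : X) :
    ⟪gradient G μ Φ B f (x, none), gradient G μ Φ B g (x, none)⟫_ℂ =
      ⟪B x (f x), B x (g x)⟫_ℂ * μ x := by
  rw [gradient_none, gradient_none, inner_smul_left, inner_smul_right, Complex.conj_ofReal,
    ← mul_assoc, ← Complex.ofReal_mul, Real.mul_self_sqrt (μ.pos x).le, mul_comm]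

/-- Finite energy controls `|f y|` by `|f x|` plus the difference along the edge, and `∑ b(x,y) < ∞`
absorbs the bounded part. Hence the form domain lies in `F_E` even without (FC). -/
theorem mem_formalDomain_of_memℓp_gradient {f : ∀ x, E x}
    (hf : Memℓp (gradient G μ Φ B f) 2) : f ∈ formalDomain E G := by
  intro x
  have h1 : Summable fun p => ‖gradient G μ Φ B f p‖ ^ 2 := by
    simpa using (memℓp_gen_iff (by norm_num)).1 hf
  have hinj : Function.Injective fun y : X => (x, some y) := fun y z h => by simpa using h
  have h2 : Summable fun y => G.b x y / 2 * ‖f x - Φ.map x y (f y)‖ ^ 2 :=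
    (h1.comp_injective hinj).congr fun y => norm_gradient_some_sq f x y
  refine Summable.of_nonneg_of_le (fun y => mul_nonneg (G.nonneg x y) (norm_nonneg _))
    (fun y => ?_) ((((G.summable x).mul_right (‖f x‖ + 1))).add (h2.mul_left 2))
  have h3 : ‖f y‖ ≤ ‖f x‖ + ‖f x - Φ.map x y (f y)‖ := by
    rw [← LinearIsometryEquiv.norm_map (Φ.map x y) (f y)]
    exact norm_le_norm_add_norm_sub _ _
  have h4 : ‖f x - Φ.map x y (f y)‖ ≤ 1 + ‖f x - Φ.map x y (f y)‖ ^ 2 := by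
    nlinarith [sq_nonneg (‖f x - Φ.map x y (f y)‖ - 1)]
  calc G.b x y * ‖f y‖ ≤ G.b x y * (‖f x‖ + (1 + ‖f x - Φ.map x y (f y)‖ ^ 2)) :=
        mul_le_mul_of_nonneg_left (by linarith) (G.nonneg x y)
    _ = _ := by ring

/-- The function on vertices and edges that is nonzero only at the vertex `x` and on the edges
leaving and entering `x`. -/
def starFunction {A : Type*} [AddCommMonoid A] (x : X) (a : A) (s t : X → A)
    (p : X × Option X) : A := by
  classical
  exact (if p = (x, none) then a else 0) + (match p with
    | (_, none) => 0
    | (z, some y) => (if z = x then s y else 0) + (if y = x then t z else 0))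

open Classical in
theorem starFunction_none {A : Type*} [AddCommMonoid A] (x z : X) (a : A) (s t : X → A) :
    starFunction x a s t (z, none) = if z = x then a else 0 := by
  simp [starFunction]

open Classical in
theorem starFunction_some {A : Type*} [AddCommMonoid A] (x z y : X) (a : A) (s t : X → A) :
    starFunction x a s t (z, some y) =
      (if z = x then s y else 0) + (if y = x then t z else 0) := by
  simp [starFunction]

/-- Reduces sums over all vertices and ordered edges to two sums over `X`, which suffices for
pairings with the gradient of a section supported at `x`. At the loop of `x` both contributions add;
in the applications they carry the factor `b x x = 0`. -/
theorem hasSum_starFunction {A : Type*} [AddCommMonoid A] [TopologicalSpace A] [ContinuousAdd A]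
    (x : X) (a : A) {s t : X → A} {S T : A} (hs : HasSum s S) (ht : HasSum t T) :
    HasSum (starFunction x a s t) (a + (S + T)) := by
  classical
  have h0 : HasSum (fun p : X × Option X => if p = (x, none) then a else 0) a :=
    hasSum_ite_eq _ _
  have i1 : Function.Injective fun y : X => (x, some y) := fun y z h => by simpa using h
  have i2 : Function.Injective fun z : X => (z, some x) := fun y z h => by simpa using h
  let F1 : X × Option X → A := fun p => match p with
    | (_, none) => 0
    | (z, some y) => if z = x then s y else 0
  let F2 : X × Option X → A := fun p => match p with
    | (_, none) => 0
    | (z, some y) => if y = x then t z else 0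
  have h1 : HasSum F1 S := by
    rw [← i1.hasSum_iff]
    · simpa [F1, Function.comp_def] using hs
    · rintro ⟨z, _ | y⟩ hp
      · rfl
      · exact if_neg fun h => hp ⟨y, by rw [h]⟩
  have h2 : HasSum F2 T := by
    rw [← i2.hasSum_iff]
    · simpa [F2, Function.comp_def] using ht
    · rintro ⟨z, _ | y⟩ hp
      · rfl
      · exact if_neg fun h => hp ⟨z, by rw [h]⟩
  convert! h0.add (h1.add h2) using 1
  funext ⟨z, o⟩
  cases o <;> simp [starFunction, F1, F2]

theorem memℓp_gradient_single (x : X) (ξ : E x) :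
    Memℓp (gradient G μ Φ B (EllTwo.toSection E μ (EllTwo.single μ x ξ))) 2 := by
  rw [memℓp_gen_iff (by norm_num)]
  have hs := (G.summable x).mul_right (‖ξ‖ ^ 2)
  have h := (hasSum_starFunction x
    (‖gradient G μ Φ B (EllTwo.toSection E μ (EllTwo.single μ x ξ)) (x, none)‖ ^ 2)
    hs.hasSum hs.hasSum).summable
  refine Summable.of_nonneg_of_le (fun _ => by positivity) ?_ h
  rintro ⟨z, _ | y⟩
  · rw [starFunction_none]
    split_ifs with hz
    · subst hz; simp
    · simp [gradient_none, EllTwo.single_apply_of_ne hz]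
  · rw [starFunction_some]
    simp only [ENNReal.toReal_ofNat, Real.rpow_ofNat]
    rw [norm_gradient_some_sq]
    have hb := G.nonneg z y
    by_cases hz : z = x <;> by_cases hy : y = x
    · subst hz; subst hy; simp [G.loopless]
    · subst hz
      rw [EllTwo.single_apply_self, EllTwo.single_apply_of_ne hy]
      simp only [map_zero, sub_zero, if_true, if_neg hy, add_zero]
      nlinarith [sq_nonneg ‖ξ‖, mul_nonneg hb (sq_nonneg ‖ξ‖)]
    · subst hy
      rw [EllTwo.single_apply_self, EllTwo.single_apply_of_ne hz, zero_sub, norm_neg,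
        LinearIsometryEquiv.norm_map, G.symm y z]
      simp only [if_true, if_neg hz, zero_add]
      nlinarith [sq_nonneg ‖ξ‖, mul_nonneg hb (sq_nonneg ‖ξ‖)]
    · simp [EllTwo.single_apply_of_ne hz, EllTwo.single_apply_of_ne hy, hz, hy]

/-- The gradient as an operator between Hilbert spaces, on its maximal domain. -/
def gradientOperator (G : WeightedGraph X) (μ : Weight X) (Φ : UnitaryConnection E)
    (B : ∀ x, E x →L[ℂ] E x) :
    EllTwo E μ →ₗ.[ℂ] lp (fun p : X × Option X => E p.1) 2 where
  domain :=
    { carrier := {f | Memℓp (gradient G μ Φ B (EllTwo.toSection E μ f)) 2}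
      add_mem' := fun {f g} hf hg => by
        simp only [Set.mem_ofPred_eq, map_add] at *
        exact hf.add hg
      zero_mem' := by
        simp only [Set.mem_ofPred_eq, map_zero]
        exact zero_memℓp
      smul_mem' := fun c f hf => by
        simp only [Set.mem_ofPred_eq, map_smul] at *
        exact hf.const_smul c }
  toFun :=
    { toFun := fun f => ⟨gradient G μ Φ B (EllTwo.toSection E μ f), f.2⟩
      map_add' := fun f g => Subtype.ext <| by
        simp only [Submodule.coe_add, map_add]
        rfl
      map_smul' := fun c f => Subtype.ext <| by
        simp only [Submodule.coe_smul, map_smul]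
        rfl }

theorem gradientOperator_apply (f : (gradientOperator G μ Φ B).domain) (p : X × Option X) :
    gradientOperator G μ Φ B f p = gradient G μ Φ B (EllTwo.toSection E μ f) p := rfl

theorem continuous_gradient_apply (p : X × Option X) :
    Continuous fun f : EllTwo E μ => gradient G μ Φ B (EllTwo.toSection E μ f) p := by
  have hc := fun x => continuous_toSection_apply (E := E) (μ := μ) x
  obtain ⟨x, _ | y⟩ := p
  · exact ((B x).continuous.comp (hc x)).const_smul _
  · exact ((hc x).sub ((Φ.map x y).continuous.comp (hc y))).const_smul _

/-- On the maximal domain the graph is cut out by the coordinate equations alone, and each of these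
is a closed condition since evaluations are continuous. -/
theorem gradientOperator_isClosed : (gradientOperator G μ Φ B).IsClosed := by
  have h : ((gradientOperator G μ Φ B).graph :
      Set (EllTwo E μ × lp (fun p : X × Option X => E p.1) 2)) =
      ⋂ p, {q | q.2 p = gradient G μ Φ B (EllTwo.toSection E μ q.1) p} := by
    ext ⟨f, k⟩
    simp only [SetLike.mem_coe, Set.mem_iInter, Set.mem_ofPred_eq]
    constructor
    · intro h p
      obtain ⟨f, rfl, rfl⟩ := (LinearPMap.mem_graph_iff _).1 h
      rfl
    · intro h
      have hk : (k : ∀ p : X × Option X, E p.1) = gradient G μ Φ B (EllTwo.toSection E μ f) :=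
        funext h
      refine (LinearPMap.mem_graph_iff _).2 ⟨⟨f, ?_⟩, rfl, Subtype.ext hk.symm⟩
      exact (show Memℓp (gradient G μ Φ B (EllTwo.toSection E μ f)) 2 from hk ▸ lp.memℓp k)
  rw [LinearPMap.IsClosed, h]
  exact isClosed_iInter fun p => isClosed_eq
    ((lp.evalCLM ℂ (fun p : X × Option X => E p.1) 2 p).continuous.comp continuous_snd)
    ((continuous_gradient_apply p).comp continuous_fst)

theorem single_mem_gradientOperator_domain (x : X) (ξ : E x) :
    EllTwo.single μ x ξ ∈ (gradientOperator G μ Φ B).domain := memℓp_gradient_single x ξ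

variable [∀ x, CompleteSpace (E x)] {W : SelfAdjointEndomorphism E}

/-- Green's formula for the gradient. -/
theorem inner_gradientOperator_single (hB : ∀ x ξ η, ⟪B x ξ, B x η⟫_ℂ = ⟪W.map x ξ, η⟫_ℂ)
    (f : (gradientOperator G μ Φ B).domain) (hf : EllTwo.toSection E μ f ∈ formalDomain E G)
    (x : X) (ξ : E x) :
    ⟪gradientOperator G μ Φ B f, gradientOperator G μ Φ B
      ⟨EllTwo.single μ x ξ, single_mem_gradientOperator_domain x ξ⟩⟫_ℂ =
    ⟪formalOperator G μ Φ W ⟨EllTwo.toSection E μ f, hf⟩ x, ξ⟫_ℂ * μ x := by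
  -- Every edge at `x` occurs as `(x, y)` and as `(y, x)`. By `Φ_{y,x} = Φ_{x,y}⁻¹` the two
  -- orientations contribute the same, each with weight `b / 2`, so half of the vertex sum is used
  -- twice.
  have h1 := (hasSum_inner_formalOperator (μ := μ) (Φ := Φ) (W := W)
    ⟨EllTwo.toSection E μ f, hf⟩ x ξ).div_const 2
  have h2 := hasSum_starFunction x
    (⟪gradient G μ Φ B (EllTwo.toSection E μ f) (x, none),
      gradient G μ Φ B (EllTwo.toSection E μ (EllTwo.single μ x ξ)) (x, none)⟫_ℂ) h1 h1
  refine (lp.hasSum_inner _ _).unique ?_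
  convert! h2 using 1
  · funext ⟨z, o⟩
    rw [gradientOperator_apply, gradientOperator_apply]
    rcases o with _ | y
    · rw [starFunction_none]
      split_ifs with hz
      · subst hz; rfl
      · rw [gradient_none (EllTwo.toSection E μ (EllTwo.single μ x ξ)),
          EllTwo.single_apply_of_ne hz, map_zero, smul_zero, inner_zero_right]
    · rw [starFunction_some, inner_gradient_some]
      by_cases hz : z = x <;> by_cases hy : y = x
      · subst hz; subst hy; simp [G.loopless]
      · subst hz
        rw [EllTwo.single_apply_self, EllTwo.single_apply_of_ne hy, map_zero, sub_zero, if_pos rfl,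
          if_neg hy, add_zero]
        ring
      · subst hy
        rw [EllTwo.single_apply_self, EllTwo.single_apply_of_ne hz, zero_sub, if_neg hz,
          if_pos rfl, zero_add, inner_neg_right, inner_sub_left, inner_sub_left, Φ.inner_map_map,
          Φ.inner_map_left, G.symm z y]
        ring
      · simp [EllTwo.single_apply_of_ne hz, EllTwo.single_apply_of_ne hy, hz, hy]
  · rw [inner_gradient_none, EllTwo.single_apply_self, hB]
    ring

/-- Fibrewise square roots of `W` turn the whole form into `‖D f‖²`. Testing `D⋆D f` against
sections supported at `x` determines its value at `x`, which Green's formula identifies with `𝓜 f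
x`. -/
theorem exists_isRealization (hW : W.Nonneg) :
    ∃ M : EllTwo E μ →ₗ.[ℂ] EllTwo E μ, IsRealization G μ Φ W M := by
  have hsqrt : ∀ x, ∃ S : E x →L[ℂ] E x, ∀ ξ η, ⟪S ξ, S η⟫_ℂ = ⟪W.map x ξ, η⟫_ℂ := by
    intro x
    have hpos : 0 ≤ W.map x := by
      rw [ContinuousLinearMap.nonneg_iff_isPositive]
      exact ⟨(W.selfAdjoint x).isSymmetric, hW x⟩
    obtain ⟨S, hS, hSS⟩ := CStarAlgebra.nonneg_iff_exists_isSelfAdjoint_and_eq_mul_self.1 hpos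
    refine ⟨S, fun ξ η => ?_⟩
    rw [hSS]
    exact (hS.isSymmetric (S ξ) η).symm
  choose B hB using hsqrt
  obtain ⟨M, h1, h2, h3, h4⟩ := exists_adjoint_comp_self (gradientOperator G μ Φ B)
    gradientOperator_isClosed (dense_of_single_mem single_mem_gradientOperator_domain)
  refine ⟨M, h1, h2, fun f hf => h3 (finSupp_le_of_single_mem
    single_mem_gradientOperator_domain hf), fun f => ?_⟩
  obtain ⟨g, hg, hgM⟩ := h4 f
  rw [← hg]
  have hd : EllTwo.toSection E μ g ∈ formalDomain E G := mem_formalDomain_of_memℓp_gradient g.2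
  refine ⟨hd, funext fun x => ext_inner_right ℂ fun ξ => ?_⟩
  have h := hgM ⟨EllTwo.single μ x ξ, single_mem_gradientOperator_domain x ξ⟩
  rw [inner_gradientOperator_single hB g hd, EllTwo.inner_single_right] at h
  exact mul_right_cancel₀ (Complex.ofReal_ne_zero.2 (μ.pos x).ne') h

end Form

/-! ### Essential self-adjointness of the minimal operator under (FC). -/

section Minimal

variable {X : Type u} {E : X → Type v} [∀ x, NormedAddCommGroup (E x)]
  [∀ x, InnerProductSpace ℂ (E x)] [∀ x, CompleteSpace (E x)]
  {G : WeightedGraph X} {μ : Weight X} {Φ : UnitaryConnection E} {W : SelfAdjointEndomorphism E}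

theorem formalOperator_single (x : X) (ξ : E x)
    (h : EllTwo.toSection E μ (EllTwo.single μ x ξ) ∈ formalDomain E G) (z : X) :
    formalOperator G μ Φ W ⟨_, h⟩ z =
      EllTwo.single μ x ((((1 / μ x * ∑' y, G.b x y : ℝ)) : ℂ) • ξ + W.map x ξ) z -
        ((G.b z x / μ z : ℝ) : ℂ) • Φ.map z x ξ := by
  change ((1 / μ z : ℝ) : ℂ) • (∑' y, (G.b z y : ℂ) • (EllTwo.single μ x ξ z -
    Φ.map z y (EllTwo.single μ x ξ y))) + W.map z (EllTwo.single μ x ξ z) = _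
  by_cases hz : z = x
  · subst hz
    have e : ∀ y, (G.b z y : ℂ) • (EllTwo.single μ z ξ z - Φ.map z y (EllTwo.single μ z ξ y)) =
        (G.b z y : ℂ) • ξ := fun y => by
      by_cases hy : y = z
      · subst hy; simp [G.loopless]
      · rw [EllTwo.single_apply_self, EllTwo.single_apply_of_ne hy, map_zero, sub_zero]
    have hs : Summable fun y => (G.b z y : ℂ) := Complex.summable_ofReal.2 (G.summable z)
    rw [tsum_congr e, hs.tsum_smul_const, EllTwo.single_apply_self, EllTwo.single_apply_self,
      G.loopless, ← Complex.ofReal_tsum, smul_smul, ← Complex.ofReal_mul]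
    simp
  · rw [tsum_eq_single x fun y hy => by
      rw [EllTwo.single_apply_of_ne hz, EllTwo.single_apply_of_ne hy, map_zero, sub_zero,
        smul_zero], EllTwo.single_apply_of_ne hz, EllTwo.single_apply_of_ne hz,
      EllTwo.single_apply_self, map_zero, add_zero, zero_sub, zero_sub, smul_neg, smul_neg,
      smul_smul, ← Complex.ofReal_mul]
    rw [one_div_mul_eq_div]

/-- Green's formula for the minimal operator. -/
theorem inner_minimalOperator_single (hFC : G.FC μ) (f : EllTwo E μ)
    (hf : EllTwo.toSection E μ f ∈ formalDomain E G) (x : X) (ξ : E x) :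
    ⟪f, minimalOperator hFC Φ W ⟨EllTwo.single μ x ξ, EllTwo.single_mem_finSupp x ξ⟩⟫_ℂ =
      ⟪formalOperator G μ Φ W ⟨EllTwo.toSection E μ f, hf⟩ x, ξ⟫_ℂ * μ x := by
  have h1 := hasSum_inner_formalOperator (μ := μ) (Φ := Φ) (W := W)
    ⟨EllTwo.toSection E μ f, hf⟩ x ξ
  have h2 : HasSum (fun y => (G.b x y : ℂ) * ⟪f x, ξ⟫_ℂ) (((∑' y, G.b x y : ℝ) : ℂ) * ⟪f x, ξ⟫_ℂ) :=
    (Complex.hasSum_ofReal.2 (G.summable x).hasSum).mul_right _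
  -- What remains is the sum of `b(x,y) ⟪Φ_{x,y} f y, ξ⟫`, the off-diagonal part of the pairing; `η`
  -- below is the diagonal part of `𝓜` applied to `ξ`.
  have h3 := h2.sub h1
  obtain ⟨η, hη⟩ : ∃ η : E x, η = (((1 / μ x * ∑' y, G.b x y : ℝ)) : ℂ) • ξ + W.map x ξ := ⟨_, rfl⟩
  have h4 : HasSum (fun z => ⟪f z, EllTwo.single μ x η z⟫_ℂ * μ z) (⟪f x, η⟫_ℂ * μ x) := by
    have := hasSum_single (f := fun z => ⟪f z, EllTwo.single μ x η z⟫_ℂ * μ z) x fun z hz => by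
      rw [EllTwo.single_apply_of_ne hz, inner_zero_right, zero_mul]
    rwa [EllTwo.single_apply_self] at this
  rw [EllTwo.inner_def]
  have hμ : (μ x : ℂ) ≠ 0 := Complex.ofReal_ne_zero.2 (μ.pos x).ne'
  refine HasSum.tsum_eq ?_
  convert! h4.sub h3 using 1
  · funext z
    have hz : (μ z : ℂ) ≠ 0 := Complex.ofReal_ne_zero.2 (μ.pos z).ne'
    change ⟪f z, formalOperator G μ Φ W ⟨EllTwo.toSection E μ (EllTwo.single μ x ξ), _⟩ z⟫_ℂ * _ = _
    rw [formalOperator_single, ← hη, inner_sub_right, inner_smul_right, inner_sub_left,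
      Φ.inner_map_left, G.symm z x]
    push_cast
    field_simp
    ring
  · have hW : ⟪W.map x (f x), ξ⟫_ℂ = ⟪f x, W.map x ξ⟫_ℂ := (W.selfAdjoint x).isSymmetric _ _
    rw [hη, inner_add_right, inner_smul_right, hW]
    push_cast
    field_simp
    ring

/-- A realization has finitely supported sections only in its form domain by definition. Green's
formula makes `M` and `M^min` formal adjoints, so `M^min ≤ M⋆ = M` puts them in the operator domain.
-/
theorem IsRealization.minimalOperator_le (hFC : G.FC μ) {M : EllTwo E μ →ₗ.[ℂ] EllTwo E μ}
    (hM : IsRealization G μ Φ W M) : minimalOperator hFC Φ W ≤ M := by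
  have h : M.IsFormalAdjoint (minimalOperator hFC Φ W) := by
    let s : Set (EllTwo E μ) := Set.range fun p : Σ x, E x => EllTwo.single μ p.1 p.2
    have hspan : finSupp E μ ≤ Submodule.span ℂ s := finSupp_le_of_single_mem fun x ξ =>
      Submodule.subset_span (Set.mem_range_self (⟨x, ξ⟩ : Σ x, E x))
    refine isFormalAdjoint_of_span (s := s) ?_ hspan ?_
    · rintro _ ⟨⟨x, ξ⟩, rfl⟩
      exact EllTwo.single_mem_finSupp x ξ
    · rintro f _ ⟨⟨x, ξ⟩, rfl⟩
      obtain ⟨hf, hMf⟩ := hM.restriction f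
      refine Eq.trans ?_ (inner_minimalOperator_single hFC (f : EllTwo E μ) hf x ξ).symm
      rw [EllTwo.inner_single_right, hMf]
  have := h.le_adjoint hM.selfAdjoint.dense_domain
  rwa [LinearPMap.isSelfAdjoint_def.1 hM.selfAdjoint] at this

/-- By (FC) all of `ℓ²` lies in `F_E`, so a vector `g` orthogonal to the range may be inserted into
`𝓜`; testing on sections supported at a point gives `𝓜 g = -c g`, hence `g = 0`. -/
theorem dense_range_minimalOperator_add (hG : G.InfinitePathsHaveInfiniteMeasure μ)
    (hW : W.Nonneg) (hFC : G.FC μ) {c : ℝ} (hc : 0 < c) :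
    Dense (Set.range fun f : (minimalOperator hFC Φ W).domain =>
      minimalOperator hFC Φ W f + (c : ℂ) • (f : EllTwo E μ)) := by
  let S : (minimalOperator hFC Φ W).domain →ₗ[ℂ] EllTwo E μ :=
    (minimalOperator hFC Φ W).toFun + (c : ℂ) • (minimalOperator hFC Φ W).domain.subtype
  have h : Dense (LinearMap.range S : Set (EllTwo E μ)) := dense_of_inner_eq_zero fun g hg => by
    have hd := mem_formalDomain_of_FC hFC g
    refine eq_zero_of_formalOperator_eq_neg (Φ := Φ) hG hW g hd hc fun x =>
      ext_inner_right ℂ fun ξ => ?_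
    have h1 : ⟪g, minimalOperator hFC Φ W ⟨EllTwo.single μ x ξ, EllTwo.single_mem_finSupp x ξ⟩ +
      (c : ℂ) • EllTwo.single μ x ξ⟫_ℂ = 0 := hg _ ⟨_, rfl⟩
    rw [inner_add_right, inner_smul_right, inner_minimalOperator_single hFC g hd,
      EllTwo.inner_single_right, ← mul_assoc, ← add_mul, mul_eq_zero] at h1
    rw [inner_neg_left, inner_smul_left, Complex.conj_ofReal]
    exact eq_neg_of_add_eq_zero_left
      (h1.resolve_right (Complex.ofReal_ne_zero.2 (μ.pos x).ne'))
  exact h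

theorem isEssentiallySelfAdjoint_minimalOperator (hG : G.InfinitePathsHaveInfiniteMeasure μ)
    (hW : W.Nonneg) (hFC : G.FC μ) :
    IsEssentiallySelfAdjoint (minimalOperator hFC Φ W) := by
  obtain ⟨M, hM⟩ := exists_isRealization (G := G) (μ := μ) (Φ := Φ) hW
  obtain ⟨C, hC⟩ := hM.lowerSemibounded
  exact isEssentiallySelfAdjoint_of_le hM.selfAdjoint (hM.minimalOperator_le hFC) hC
    (c := 1 + |C|) (by linarith [neg_abs_le C])
    (dense_range_minimalOperator_add hG hW hFC (by positivity))

end Minimal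

theorem infinitePathsHaveInfiniteMeasure_of_iInf_pos {X : Type u} (G : WeightedGraph X)
    (μ : Weight X) (h : 0 < ⨅ x, μ x) : G.InfinitePathsHaveInfiniteMeasure μ := by
  intro p _
  have hbdd : BddBelow (Set.range μ) := ⟨0, by rintro _ ⟨x, rfl⟩; exact (μ.pos x).le⟩
  refine top_le_iff.1 (le_trans ?_ (ENNReal.tsum_le_tsum fun n =>
    ENNReal.ofReal_le_ofReal (ciInf_le hbdd (p n))))
  rw [ENNReal.tsum_const_eq_top_of_ne_zero (ENNReal.ofReal_pos.2 h).ne']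

end MagneticSchrodinger

end

theorem mainTheorem7 {X : Type*} [Countable X] [Nonempty X]
    {E : X → Type*} [∀ x, NormedAddCommGroup (E x)] [∀ x, InnerProductSpace ℂ (E x)]
    [∀ x, CompleteSpace (E x)] [∀ x, Nontrivial (E x)]
    (G : MagneticSchrodinger.WeightedGraph X) (μ : MagneticSchrodinger.Weight X)
    (Φ : MagneticSchrodinger.UnitaryConnection E)
    (W : MagneticSchrodinger.SelfAdjointEndomorphism E) (hW : W.Nonneg) :
    ((0 < ⨅ x, μ x) → G.InfinitePathsHaveInfiniteMeasure μ) ∧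
    (G.InfinitePathsHaveInfiniteMeasure μ →
      (∃! M : MagneticSchrodinger.EllTwo E μ →ₗ.[ℂ] MagneticSchrodinger.EllTwo E μ,
        MagneticSchrodinger.IsRealization G μ Φ W M) ∧
      ∀ hFC : G.FC μ, MagneticSchrodinger.IsEssentiallySelfAdjoint
        (MagneticSchrodinger.minimalOperator hFC Φ W)) := by
  refine ⟨MagneticSchrodinger.infinitePathsHaveInfiniteMeasure_of_iInf_pos G μ, fun hG => ⟨?_, fun hFC =>
    MagneticSchrodinger.isEssentiallySelfAdjoint_minimalOperator hG hW hFC⟩⟩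
  obtain ⟨M, hM⟩ := MagneticSchrodinger.exists_isRealization (G := G) (μ := μ) (Φ := Φ) hW
  exact ⟨M, hM, fun N hN => hN.unique hG hW hM⟩
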